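/- Let $d\ge 0$ be an integer, let $\mathbb R^d$ carry the Euclidean norm, and let ${\rm CO}(\mathbb R^d)$ be the set of all closed convex subsets of $\mathbb R^d$ (including $\emptyset$), ordered by inclusion. It is a complete lattice with $\inf_\alpha A_\alpha=\bigcap_\alpha A_\alpha$ and $\sup_\alpha A_\alpha=\overline{\rm conv}\big(\bigcup_\alpha A_\alpha\big)$. Equip it with the extended Wijsman topology, i.e. the smallest topology for which the maps $A\mapsto d(x,A)=\inf_{y\in A}\|x-y\|\in[0,\infty]$, $x\in\mathbb R^d$, are continuous, where $d(x,\emptyset)=\infty$, and with the Borel $\sigma$-algebra $\mathcal S$ of this topology. Then, with $S={\rm CO}(\mathbb R^d)$: (A1) the set $\{(A,B)\in S^2: A\subseteq B\}$ lies in the product $\sigma$-algebra $\mathcal S\otimes\mathcal S$; (A2) the maps $(A_1,A_2,\ldots)\mapsto\sup_n A_n$ and $(A_1,A_2,\ldots)\mapsto\inf_n A_n$ from $S^\infty$, with the product $\sigma$-algebra, to $S$ are measurable; (A3) there exists a measurable map $\phi\colon S\to\mathbb R$ that is strictly increasing, i.e. $A\subsetneq B$ implies $\phi(A)<\phi(B)$.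 Moreover, let $\mu$ be the standard Gaussian distribution on $\mathbb R^d$. For every nonempty affine subspace $V\subseteq\mathbb R^d$ there is a law $\mu(\,\cdot\mid V)$ of a standard Gaussian vector conditioned to lie in $V$, namely the probability measure that is the weak limit, as $\varepsilon\downarrow0$, of the conditional laws $\mu(\,\cdot\,\cap V_\varepsilon)/\mu(V_\varepsilon)$, where $V_\varepsilon=\{x: d(x,V)\le\varepsilon\}$; and a strictly increasing measurable map $\phi\colon S\to\mathbb R$ is given by \[ \phi(A)=\dim({\rm aff}\,A)+\mu(A\mid{\rm aff}\,A), \] with the conventions $\dim(\emptyset)=-1$ and $\mu(\emptyset\mid\emptyset)=0$. -/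

import Mathlib

open MeasureTheory ProbabilityTheory Filter Topology
open scoped BoundedContinuousFunction

noncomputable section

namespace ConvexLattice

/-! ### Measurable complete lattices -/

/-- The triangle `{(x, y) | x ≤ y}` lies in the product σ-algebra. -/
def A1 (S : Type*) [CompleteLattice S] [MeasurableSpace S] : Prop :=
  MeasurableSet {p : S × S | p.1 ≤ p.2}

/-- The countable supremum and infimum maps are measurable, for the product σ-algebra on the
set of sequences. -/
def A2 (S : Type*) [CompleteLattice S] [MeasurableSpace S] : Prop :=
  Measurable (fun x : ℕ → S => ⨆ n, x n) ∧ Measurable (fun x : ℕ → S => ⨅ n, x n)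

/-- There is a strictly increasing measurable real-valued map. -/
def A3 (S : Type*) [CompleteLattice S] [MeasurableSpace S] : Prop :=
  ∃ φ : S → ℝ, StrictMono φ ∧ Measurable φ

/-! ### Closed subsets of a metric space and the extended Wijsman topology -/

/-- The closed subsets of `X`, the empty set included. -/
@[ext]
structure CL0 (X : Type*) [MetricSpace X] where
  carrier : Set X
  isClosed : IsClosed carrier

/-- The extended Wijsman topology: the smallest topology for which all the distance maps
`A ↦ d(x, A) ∈ [0, ∞]` are continuous, where `d(x, ∅) = ∞`. So `A i → A` if and only if
`d(x, A i) → d(x, A)` for all `x`; in particular `A i → ∅` if and only if `d(x, A i) → ∞`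
for all `x`, and on nonempty closed sets this is the usual Wijsman topology. -/
instance (X : Type*) [MetricSpace X] : TopologicalSpace (CL0 X) :=
  ⨅ x : X, TopologicalSpace.induced (fun A => Metric.infEDist x A.carrier) inferInstance

/-! ### Closed convex subsets of Euclidean space -/

/-- `ℝ^d` with the Euclidean norm. -/
abbrev E (d : ℕ) : Type := EuclideanSpace ℝ (Fin d)

/-- The closed convex subsets of `ℝ^d`, the empty set included. -/
@[ext]
structure CO (d : ℕ) extends CL0 (E d) where
  convex : Convex ℝ carrier

theorem CO.carrier_injective (d : ℕ) : Function.Injective (fun A : CO d => A.carrier) := by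
  intro A B h
  exact CO.ext h

/-- The subspace topology. -/
instance (d : ℕ) : TopologicalSpace (CO d) :=
  TopologicalSpace.induced CO.toCL0 inferInstance

/-- The Borel σ-algebra. -/
instance (d : ℕ) : MeasurableSpace (CO d) := borel (CO d)

/-- The order is set inclusion. -/
instance (d : ℕ) : PartialOrder (CO d) :=
  PartialOrder.lift (fun A => A.carrier) (CO.carrier_injective d)

/-- The closed convex hull of a set, as an element of the lattice. -/
def CO.hull {d : ℕ} (s : Set (E d)) : CO d where
  carrier := closure (convexHull ℝ s)
  isClosed := isClosed_closure
  convex := (convex_convexHull ℝ s).closure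

theorem CO.hull_le {d : ℕ} {s : Set (E d)} {B : CO d} (h : s ⊆ B.carrier) : CO.hull s ≤ B :=
  closure_minimal (convexHull_min h B.convex) B.isClosed

theorem CO.subset_hull {d : ℕ} (s : Set (E d)) : s ⊆ (CO.hull s).carrier :=
  (subset_convexHull ℝ s).trans subset_closure

/-- Suprema are closed convex hulls of unions, infima are intersections. -/
instance (d : ℕ) : CompleteLattice (CO d) where
  sup A B := CO.hull (A.carrier ∪ B.carrier)
  le_sup_left _ _ := Set.subset_union_left.trans (CO.subset_hull _)
  le_sup_right _ _ := Set.subset_union_right.trans (CO.subset_hull _)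
  sup_le _ _ _ h₁ h₂ := CO.hull_le (Set.union_subset h₁ h₂)
  inf A B := ⟨⟨A.carrier ∩ B.carrier, A.isClosed.inter B.isClosed⟩, A.convex.inter B.convex⟩
  inf_le_left _ _ := Set.inter_subset_left
  inf_le_right _ _ := Set.inter_subset_right
  le_inf _ _ _ h₁ h₂ := Set.subset_inter h₁ h₂
  sSup 𝒜 := CO.hull (⋃ A ∈ 𝒜, A.carrier)
  isLUB_sSup 𝒜 :=
    ⟨fun _ hA => (Set.subset_biUnion_of_mem (u := fun A : CO d => A.carrier) hA).trans
      (CO.subset_hull _), fun _ hB => CO.hull_le (Set.iUnion₂_subset fun _ hA => hB hA)⟩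
  sInf 𝒜 := ⟨⟨⋂ A ∈ 𝒜, A.carrier, isClosed_biInter fun A _ => A.isClosed⟩,
    convex_iInter₂ fun A _ => A.convex⟩
  isGLB_sInf 𝒜 :=
    ⟨fun _ hA => Set.biInter_subset_of_mem (t := fun A : CO d => A.carrier) hA,
      fun _ hB => Set.subset_iInter₂ fun _ hA => hB hA⟩
  top := ⟨⟨Set.univ, isClosed_univ⟩, convex_univ⟩
  le_top _ := Set.subset_univ _
  bot := ⟨⟨∅, isClosed_empty⟩, convex_empty⟩
  bot_le _ := Set.empty_subset _

/-! ### The map `φ` -/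

/-- The dimension of an affine subspace, with the convention `dim ∅ = -1`. -/
def affDim {d : ℕ} (V : AffineSubspace ℝ (E d)) : ℤ :=
  open scoped Classical in
  if (V : Set (E d)) = ∅ then -1 else (Module.finrank ℝ V.direction : ℤ)

/-- `ν` is the law of a standard Gaussian vector of `ℝ^d` conditioned to lie in `V`: the
probability measure that is the weak limit, as `ε ↓ 0`, of the elementary conditional laws
`μ(· ∩ V_ε) / μ(V_ε)`, where `V_ε = {x | d(x, V) ≤ ε}`. -/
def IsGaussianGiven {d : ℕ} (V : AffineSubspace ℝ (E d)) (ν : Measure (E d)) : Prop :=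
  IsProbabilityMeasure ν ∧
    ∀ f : E d →ᵇ ℝ,
      Tendsto (fun ε : ℝ => ∫ x, f x ∂((stdGaussian (E d))[|Metric.cthickening ε (V : Set (E d))]))
        (𝓝[>] 0) (𝓝 (∫ x, f x ∂ν))

/-- `μ(· | V)`, the standard Gaussian distribution conditioned on the affine subspace `V`
(the zero measure for `V = ∅`). -/
def gaussianGiven {d : ℕ} (V : AffineSubspace ℝ (E d)) : Measure (E d) :=
  open scoped Classical in
  if h : ∃ ν, IsGaussianGiven V ν then h.choose else 0

/-- `φ(A) = dim (aff A) + μ(A | aff A)`. -/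
def phi {d : ℕ} (A : CO d) : ℝ :=
  (affDim (affineSpan ℝ A.carrier) : ℝ) +
    (gaussianGiven (affineSpan ℝ A.carrier)).real A.carrier

end ConvexLattice

end

noncomputable section

namespace ConvexLattice

/-! ### Distance functions and a countable dense set -/

section Distance

variable {X : Type*} [MetricSpace X] [TopologicalSpace.SeparableSpace X] [Nonempty X]

/-! The distance to a set is 1-Lipschitz in the point, so the distances from a countable dense set
of points determine all the others, and the Borel σ-algebra is generated by countably many distance
functions (`CO.measurableSpace_eq_comap`). Inclusion is then a countable family of inequalities. A
convex hull comes within `r` of `x` iff the set contains a tuple from a certain open set of tuples,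
which countably many distances detect (`measurableSet_exists_tuple_mem`); this handles suprema.
Infima rest on compactness of closed balls (`inter_iInter_nonempty_iff`).

The components of a standard Gaussian vector along `V` and orthogonal to it are independent, and the
thickening of `V` constrains only the second. The conditional laws therefore converge to the law of
the orthogonal projection to `V` (`isGaussianGiven_gaussianOn`). The mass of `A` under this law is
the Gaussian probability that a point is as close to `A` as to its affine span, a measurable
function of `A` by Fubini; the dimension is detected by affinely independent tuples.

For strict monotonicity, if the affine spans agree, the difference contains a nonempty relatively
open set, of positive mass. If the span grows, so does the dimension, and `phi A` lies in `(dim, dim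
+ 1]` for nonempty `A`. -/

theorem exists_edist_denseSeq_lt (x : X) {ε : ENNReal} (hε : 0 < ε) :
    ∃ n, edist x (TopologicalSpace.denseSeq X n) < ε := by
  obtain ⟨y, ⟨n, rfl⟩, hy⟩ := EMetric.mem_closure_iff.1
    (TopologicalSpace.denseRange_denseSeq X x) ε hε
  exact ⟨n, hy⟩

theorem infEDist_eq_iInf_denseSeq (x : X) (s : Set X) :
    Metric.infEDist x s = ⨅ n, (Metric.infEDist (TopologicalSpace.denseSeq X n) s +
      edist x (TopologicalSpace.denseSeq X n)) := by
  refine le_antisymm (le_iInf fun n => Metric.infEDist_le_infEDist_add_edist) ?_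
  refine ENNReal.le_of_forall_pos_le_add fun ε hε _ => ?_
  have h2 : (0 : ENNReal) < ε / 2 := ENNReal.half_pos (by exact_mod_cast hε.ne')
  obtain ⟨n, hn⟩ := exists_edist_denseSeq_lt x h2
  refine (iInf_le _ n).trans ?_
  calc _ ≤ (Metric.infEDist x s + edist x (TopologicalSpace.denseSeq X n))
        + edist x (TopologicalSpace.denseSeq X n) := by
        gcongr
        rw [edist_comm]
        exact Metric.infEDist_le_infEDist_add_edist
    _ ≤ (Metric.infEDist x s + ε / 2) + ε / 2 := by gcongr
    _ = _ := by rw [add_assoc, ENNReal.add_halves]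

/-- Companion of the infimum formula: one yields lower, the other upper semicontinuity. For `s = ∅`
the truncated subtraction is harmless, as both sides are `∞`. -/
theorem infEDist_eq_iSup_denseSeq (x : X) (s : Set X) :
    Metric.infEDist x s = ⨆ n, (Metric.infEDist (TopologicalSpace.denseSeq X n) s -
      edist x (TopologicalSpace.denseSeq X n)) := by
  refine le_antisymm ?_ (iSup_le fun n => ?_)
  · refine ENNReal.le_of_forall_pos_le_add fun ε hε _ => ?_
    have h2 : (0 : ENNReal) < ε / 2 := ENNReal.half_pos (by exact_mod_cast hε.ne')
    obtain ⟨n, hn⟩ := exists_edist_denseSeq_lt x h2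
    calc Metric.infEDist x s ≤ Metric.infEDist (TopologicalSpace.denseSeq X n) s
          + edist x (TopologicalSpace.denseSeq X n) := Metric.infEDist_le_infEDist_add_edist
      _ ≤ ((Metric.infEDist (TopologicalSpace.denseSeq X n) s -
          edist x (TopologicalSpace.denseSeq X n)) + edist x (TopologicalSpace.denseSeq X n))
          + edist x (TopologicalSpace.denseSeq X n) := by gcongr; exact le_tsub_add
      _ ≤ ((⨆ n, (Metric.infEDist (TopologicalSpace.denseSeq X n) s -
          edist x (TopologicalSpace.denseSeq X n))) + ε / 2) + ε / 2 := by
        gcongr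
        exact le_iSup (fun n => Metric.infEDist (TopologicalSpace.denseSeq X n) s -
          edist x (TopologicalSpace.denseSeq X n)) n
      _ = _ := by rw [add_assoc, ENNReal.add_halves]
  · rw [tsub_le_iff_right, edist_comm]
    exact Metric.infEDist_le_infEDist_add_edist

/-- The distances to the points of a countable dense set generate the Wijsman topology. -/
theorem CL0.topology_eq_induced_denseSeq :
    (inferInstance : TopologicalSpace (CL0 X)) = TopologicalSpace.induced
      (fun (A : CL0 X) (n : ℕ) => Metric.infEDist (TopologicalSpace.denseSeq X n) A.carrier)
      inferInstance := by
  apply le_antisymm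
  · refine continuous_iff_le_induced.1 (continuous_pi fun n => ?_)
    exact continuous_iff_le_induced.2 (iInf_le _ (TopologicalSpace.denseSeq X n))
  · refine le_iInf fun x => continuous_iff_le_induced.1 ?_
    let τ : TopologicalSpace (CL0 X) := TopologicalSpace.induced
      (fun (A : CL0 X) (n : ℕ) => Metric.infEDist (TopologicalSpace.denseSeq X n) A.carrier)
      inferInstance
    have hc : ∀ n, @Continuous _ _ τ _ fun A : CL0 X =>
        Metric.infEDist (TopologicalSpace.denseSeq X n) A.carrier := fun n =>
      (continuous_apply n).comp (continuous_induced_dom (f := fun (A : CL0 X) (n : ℕ) =>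
        Metric.infEDist (TopologicalSpace.denseSeq X n) A.carrier))
    refine (@continuous_iff_lower_upperSemicontinuous _ τ _ _ _ _ _).2 ⟨?_, ?_⟩
    · simp_rw [infEDist_eq_iSup_denseSeq x]
      refine @lowerSemicontinuous_iSup _ τ _ _ _ _ fun n => ?_
      exact @Continuous.lowerSemicontinuous _ τ _ _ _ _ _
        ((ENNReal.continuous_sub_right _).comp (hc n))
    · simp_rw [infEDist_eq_iInf_denseSeq x]
      refine @upperSemicontinuous_iInf _ τ _ _ _ _ fun n => ?_
      exact @Continuous.upperSemicontinuous _ τ _ _ _ _ _ ((hc n).add continuous_const)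

end Distance

/-! ### Measurability of inclusion, countable suprema and countable infima -/

section Measurability

variable {d : ℕ} {T : Type*} [MeasurableSpace T]

/-- Since only countably many coordinates are used, the Borel σ-algebra of the product is the
product σ-algebra. -/
theorem CO.measurableSpace_eq_comap :
    (inferInstance : MeasurableSpace (CO d)) = MeasurableSpace.comap
      (fun (A : CO d) (n : ℕ) => Metric.infEDist (TopologicalSpace.denseSeq (E d) n) A.carrier)
      inferInstance := by
  have h : (inferInstance : TopologicalSpace (CO d)) = TopologicalSpace.induced
      (fun (A : CO d) (n : ℕ) => Metric.infEDist (TopologicalSpace.denseSeq (E d) n) A.carrier)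
      inferInstance := by
    change TopologicalSpace.induced CO.toCL0 inferInstance = _
    rw [CL0.topology_eq_induced_denseSeq, induced_compose]
    rfl
  change @borel _ inferInstance = _
  rw [h, borel_comap, ← (Pi.borelSpace (X := fun _ : ℕ => ENNReal)).measurable_eq]

theorem CO.measurable_infEDist (x : E d) :
    Measurable fun A : CO d => Metric.infEDist x A.carrier := by
  have hn : ∀ n, Measurable fun A : CO d =>
      Metric.infEDist (TopologicalSpace.denseSeq (E d) n) A.carrier := by
    intro n
    refine (measurable_pi_apply n).comp (measurable_iff_comap_le.2 ?_ : Measurable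
      (fun (A : CO d) (n : ℕ) => Metric.infEDist (TopologicalSpace.denseSeq (E d) n) A.carrier))
    exact CO.measurableSpace_eq_comap.ge
  simp_rw [infEDist_eq_iInf_denseSeq x]
  exact .iInf fun n => (hn n).add_const _

theorem CO.measurable_of_infEDist {f : T → CO d}
    (h : ∀ x, Measurable fun t => Metric.infEDist x (f t).carrier) : Measurable f := by
  exact (measurable_comap_iff.2 (measurable_pi_iff.2 fun n => h _)).mono le_rfl
    CO.measurableSpace_eq_comap.le

theorem CO.le_iff_infEDist {A B : CO d} : A ≤ B ↔
    ∀ n, Metric.infEDist (TopologicalSpace.denseSeq (E d) n) B.carrier ≤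
      Metric.infEDist (TopologicalSpace.denseSeq (E d) n) A.carrier := by
  refine ⟨fun h n => Metric.infEDist_anti h, fun h a ha => ?_⟩
  rw [Metric.mem_iff_infEDist_zero_of_closed B.isClosed, ← nonpos_iff_eq_zero,
    ← Metric.infEDist_zero_of_mem ha, infEDist_eq_iInf_denseSeq, infEDist_eq_iInf_denseSeq]
  exact iInf_mono fun n => add_le_add (h n) le_rfl

theorem CO.measurableSet_le : A1 (CO d) := by
  have : {p : CO d × CO d | p.1 ≤ p.2} =
      ⋂ n, {p | Metric.infEDist (TopologicalSpace.denseSeq (E d) n) p.2.carrier ≤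
        Metric.infEDist (TopologicalSpace.denseSeq (E d) n) p.1.carrier} := by
    ext p
    simp [CO.le_iff_infEDist]
  rw [A1, this]
  exact .iInter fun n => _root_.measurableSet_le ((CO.measurable_infEDist _).comp measurable_snd)
    ((CO.measurable_infEDist _).comp measurable_fst)

/-- A random set hits an open set of tuples iff it comes close to each point of a tuple of dense
points around which the open set contains a large enough ball. -/
theorem measurableSet_exists_tuple_mem {B : T → Set (E d)}
    (hB : ∀ x, Measurable fun t => Metric.infEDist x (B t)) {k : ℕ} {O : Set (Fin k → E d)}
    (hO : IsOpen O) : MeasurableSet {t | ∃ y ∈ O, ∀ i, y i ∈ B t} := by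
  let q := TopologicalSpace.denseSeq (E d)
  have : {t | ∃ y ∈ O, ∀ i, y i ∈ B t} = ⋃ p : (Fin k → ℕ) × ℕ,
      ⋃ _ : {y : Fin k → E d | ∀ i, edist (q (p.1 i)) (y i) < (p.2 + 1 : ENNReal)⁻¹} ⊆ O,
      ⋂ i, {t | Metric.infEDist (q (p.1 i)) (B t) < (p.2 + 1 : ENNReal)⁻¹} := by
    ext t
    simp only [Set.mem_ofPred_eq, Set.mem_iUnion, Set.mem_iInter, exists_prop]
    constructor
    · rintro ⟨y, hy, hyB⟩
      obtain ⟨ε, hε, hball⟩ := EMetric.isOpen_iff.1 hO y hy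
      -- Half of `ε`, because `z i` and `y i` each lie within `1 / (m + 1)` of `q (n i)`.
      obtain ⟨m, hm⟩ := ENNReal.exists_inv_nat_lt (ENNReal.half_pos hε.ne').ne'
      have hm' : (m + 1 : ENNReal)⁻¹ < ε / 2 :=
        lt_of_le_of_lt (ENNReal.inv_le_inv.2 le_self_add) hm
      have hpos : 0 < (m + 1 : ENNReal)⁻¹ := ENNReal.inv_pos.2 (by finiteness)
      choose n hn using fun i => exists_edist_denseSeq_lt (y i) hpos
      refine ⟨(n, m), fun z hz => hball ?_, fun i => ?_⟩
      · refine (Finset.sup_lt_iff hε).2 fun i _ => ?_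
        calc edist (z i) (y i) ≤ edist (z i) (q (n i)) + edist (q (n i)) (y i) :=
              edist_triangle _ _ _
          _ < ε / 2 + ε / 2 := by
              refine ENNReal.add_lt_add ?_ ?_
              · rw [edist_comm]; exact (hz i).trans hm'
              · rw [edist_comm]; exact (hn i).trans hm'
          _ = ε := ENNReal.add_halves _
      · refine Metric.infEDist_lt_iff.2 ⟨y i, hyB i, ?_⟩
        rw [edist_comm]; exact hn i
    · rintro ⟨p, hp, h⟩
      choose y hy hyd using fun i => Metric.infEDist_lt_iff.1 (h i)
      exact ⟨y, hp hyd, hy⟩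
  rw [this]
  exact .iUnion fun p => .iUnion fun _ => .iInter fun i => measurableSet_lt (hB _) measurable_const

/-- Distances to a set of combinations of points of a random set are measurable. -/
theorem measurable_infEDist_combinations (W : ∀ k, Set (Fin k → ℝ)) {B C : T → Set (E d)}
    (hB : ∀ x, Measurable fun t => Metric.infEDist x (B t))
    (hC : ∀ t z, z ∈ C t ↔ ∃ k, ∃ w ∈ W k, ∃ y : Fin k → E d, (∀ i, y i ∈ B t) ∧
      ∑ i, w i • y i = z) (x : E d) : Measurable fun t => Metric.infEDist x (C t) := by
  refine measurable_of_Iio fun r => ?_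
  have : (fun t => Metric.infEDist x (C t)) ⁻¹' Set.Iio r = ⋃ k, {t | ∃ y ∈
      ⋃ w ∈ W k, {y : Fin k → E d | edist x (∑ i, w i • y i) < r}, ∀ i, y i ∈ B t} := by
    ext t
    simp only [Set.mem_preimage, Set.mem_Iio, Metric.infEDist_lt_iff, Set.mem_iUnion,
      Set.mem_ofPred_eq, exists_prop, hC]
    constructor
    · rintro ⟨_, ⟨k, w, hw, y, hy, rfl⟩, h⟩
      exact ⟨k, y, ⟨w, hw, h⟩, hy⟩
    · rintro ⟨k, y, ⟨w, hw, h⟩, hy⟩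
      exact ⟨_, ⟨k, w, hw, y, hy, rfl⟩, h⟩
  rw [this]
  -- The union over the weights is uncountable, but it is a union of open sets of tuples, and only
  -- its openness matters.
  refine .iUnion fun k => measurableSet_exists_tuple_mem hB ?_
  exact isOpen_biUnion fun w _ => isOpen_lt (by fun_prop) continuous_const

theorem measurable_infEDist_convexHull {B : T → Set (E d)}
    (hB : ∀ x, Measurable fun t => Metric.infEDist x (B t)) (x : E d) :
    Measurable fun t => Metric.infEDist x (convexHull ℝ (B t)) := by
  refine measurable_infEDist_combinations (fun k => {w | (∀ i, 0 ≤ w i) ∧ ∑ i, w i = 1}) hB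
    (fun t z => ?_) x
  constructor
  · intro hz
    obtain ⟨ι, _, w, y, hw, hw1, hy, rfl⟩ := mem_convexHull_iff_exists_fintype.1 hz
    let e := (Fintype.equivFin ι).symm
    refine ⟨Fintype.card ι, w ∘ e, ⟨fun i => hw _, ?_⟩, y ∘ e, fun i => hy _, ?_⟩
    · simpa using (e.sum_comp w).trans hw1
    · simpa using e.sum_comp fun i => w i • y i
  · rintro ⟨k, w, ⟨hw, hw1⟩, y, hy, rfl⟩
    exact mem_convexHull_of_exists_fintype w y hw hw1 hy rfl

theorem measurable_infEDist_affineSpan {B : T → Set (E d)}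
    (hB : ∀ x, Measurable fun t => Metric.infEDist x (B t)) (x : E d) :
    Measurable fun t => Metric.infEDist x (affineSpan ℝ (B t) : Set (E d)) := by
  refine measurable_infEDist_combinations (fun k => {w | ∑ i, w i = 1}) hB (fun t z => ?_) x
  constructor
  · intro hz
    rw [SetLike.mem_coe, ← Subtype.range_coe (s := B t)] at hz
    obtain ⟨s, w, hw, rfl⟩ := eq_affineCombination_of_mem_affineSpan hz
    rw [Finset.affineCombination_eq_linear_combination _ _ _ hw]
    let e := s.equivFin.symm
    refine ⟨s.card, fun i => w (e i), ?_, fun i => (e i : B t), fun i => (e i : B t).2, ?_⟩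
    · rw [Set.mem_ofPred_eq, e.sum_comp fun i : s => w i, Finset.sum_coe_sort s w, hw]
    · rw [e.sum_comp fun i : s => w i • (i : E d), Finset.sum_coe_sort s fun i => w i • (i : E d)]
  · rintro ⟨k, w, hw, y, hy, rfl⟩
    rw [← Finset.affineCombination_eq_linear_combination _ _ _ hw]
    exact affineSpan_mono ℝ (Set.range_subset_iff.2 hy) (affineCombination_mem_affineSpan hw y)

theorem CO.iSup_carrier {ι : Type*} (A : ι → CO d) :
    (⨆ i, A i).carrier = closure (convexHull ℝ (⋃ i, (A i).carrier)) := by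
  change closure (convexHull ℝ (⋃ B ∈ Set.range A, B.carrier)) = _
  rw [Set.biUnion_range]

theorem CO.iInf_carrier {ι : Type*} (A : ι → CO d) :
    (⨅ i, A i).carrier = ⋂ i, (A i).carrier := by
  change (⋂ B ∈ Set.range A, B.carrier) = _
  rw [Set.biInter_range]

theorem CO.measurable_iSup : Measurable fun A : ℕ → CO d => ⨆ n, A n := by
  refine CO.measurable_of_infEDist fun x => ?_
  simp_rw [CO.iSup_carrier, Metric.infEDist_closure]
  refine measurable_infEDist_convexHull (fun x => ?_) x
  simp_rw [Metric.infEDist_iUnion]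
  exact .iInf fun n => (CO.measurable_infEDist x).comp (measurable_pi_apply n)

/-- A compact set meets a countable intersection of closed sets iff some dense points come close to
the compact set and to finitely many of the closed sets at once. -/
theorem inter_iInter_nonempty_iff {K : Set (E d)} (hK : IsCompact K) (A : ℕ → CO d) :
    (K ∩ ⋂ n, (A n).carrier).Nonempty ↔ ∀ m : ℕ, ∃ j,
      Metric.infEDist (TopologicalSpace.denseSeq (E d) j) K < (m + 1 : ENNReal)⁻¹ ∧
      ∀ n ≤ m, Metric.infEDist (TopologicalSpace.denseSeq (E d) j) (A n).carrier
        < (m + 1 : ENNReal)⁻¹ := by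
  have hpos : ∀ m : ℕ, 0 < (m + 1 : ENNReal)⁻¹ := fun m => ENNReal.inv_pos.2 (by finiteness)
  constructor
  · rintro ⟨y, hyK, hyA⟩ m
    obtain ⟨j, hj⟩ := exists_edist_denseSeq_lt y (hpos m)
    rw [edist_comm] at hj
    exact ⟨j, (Metric.infEDist_le_edist_of_mem hyK).trans_lt hj, fun n _ =>
      (Metric.infEDist_le_edist_of_mem (Set.mem_iInter.1 hyA n)).trans_lt hj⟩
  · intro h
    choose j hjK hjA using h
    choose y hyK hy using fun m => Metric.infEDist_lt_iff.1 (hjK m)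
    obtain ⟨a, haK, φ, hφ, hlim⟩ := hK.tendsto_subseq hyK
    refine ⟨a, haK, Set.mem_iInter.2 fun n => ?_⟩
    rw [Metric.mem_iff_infEDist_zero_of_closed (A n).isClosed]
    have hc : Tendsto (fun i => Metric.infEDist (y (φ i)) (A n).carrier) atTop
        (𝓝 (Metric.infEDist a (A n).carrier)) :=
      (Metric.continuous_infEDist.tendsto a).comp hlim
    have hinv : Tendsto (fun i : ℕ => ((φ i : ENNReal))⁻¹) atTop (𝓝 0) :=
      ENNReal.tendsto_inv_nat_nhds_zero.comp hφ.tendsto_atTop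
    have hb : Tendsto (fun i : ℕ => ((φ i : ENNReal))⁻¹ + ((φ i : ENNReal))⁻¹) atTop (𝓝 0) := by
      simpa using hinv.add hinv
    refine nonpos_iff_eq_zero.1 (le_of_tendsto_of_tendsto hc hb ?_)
    filter_upwards [eventually_ge_atTop n] with i hi
    have hn : n ≤ φ i := hi.trans (hφ.id_le i)
    have hle : (φ i + 1 : ENNReal)⁻¹ ≤ (φ i : ENNReal)⁻¹ := ENNReal.inv_le_inv.2 le_self_add
    refine (Metric.infEDist_le_infEDist_add_edist
      (y := TopologicalSpace.denseSeq (E d) (j (φ i)))).trans ?_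
    rw [edist_comm]
    exact add_le_add ((hjA (φ i) n hn).le.trans hle) ((hy (φ i)).le.trans hle)

/-- The distance from `x` is below `r` iff a closed ball around `x` of rational radius below `r`
meets the intersection; such balls are compact. -/
theorem CO.measurable_iInf : Measurable fun A : ℕ → CO d => ⨅ n, A n := by
  refine CO.measurable_of_infEDist fun x => measurable_of_Iio fun r => ?_
  have : (fun A : ℕ → CO d => Metric.infEDist x (⨅ n, A n).carrier) ⁻¹' Set.Iio r =
      ⋃ s : ℚ, ⋃ _ : ENNReal.ofReal s < r, ⋂ m : ℕ, ⋃ j, {A : ℕ → CO d |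
        Metric.infEDist (TopologicalSpace.denseSeq (E d) j) (Metric.closedBall x (s : ℝ))
          < (m + 1 : ENNReal)⁻¹} ∩ ⋂ n, ⋂ _ : n ≤ m, {A |
        Metric.infEDist (TopologicalSpace.denseSeq (E d) j) (A n).carrier
        < (m + 1 : ENNReal)⁻¹} := by
    ext A
    have hK : ∀ s : ℚ, IsCompact (Metric.closedBall x (s : ℝ)) := fun s => isCompact_closedBall _ _
    simp only [Set.mem_iUnion, Set.mem_iInter, Set.mem_inter_iff, Set.mem_ofPred_eq, exists_prop,
      ← inter_iInter_nonempty_iff (hK _) A, Set.mem_preimage, Set.mem_Iio]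
    rw [Metric.infEDist_lt_iff, CO.iInf_carrier]
    constructor
    · rintro ⟨y, hy, hlt⟩
      obtain ⟨s, hs0, hs1, hs2⟩ := ENNReal.lt_iff_exists_rat_btwn.1 hlt
      refine ⟨s, hs2, y, ?_, hy⟩
      rw [Metric.mem_closedBall']
      rw [edist_dist] at hs1
      exact (ENNReal.ofReal_le_ofReal_iff (by exact_mod_cast hs0)).1 hs1.le
    · rintro ⟨s, hs, y, hyK, hy⟩
      refine ⟨y, hy, lt_of_le_of_lt ?_ hs⟩
      rw [edist_dist]
      exact ENNReal.ofReal_le_ofReal (Metric.mem_closedBall'.1 hyK)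
  rw [this]
  refine .iUnion fun s => .iUnion fun _ => .iInter fun m => .iUnion fun j => .inter (.const _) ?_
  exact .iInter fun n => .iInter fun _ => measurableSet_lt
    ((CO.measurable_infEDist _).comp (measurable_pi_apply n)) measurable_const

end Measurability

/-! ### The standard Gaussian distribution conditioned on an affine subspace -/

section Gaussian

variable {d : ℕ}

instance : (stdGaussian (E d)).IsOpenPosMeasure := by
  have : (gaussianReal 0 1).IsOpenPosMeasure :=
    (gaussianReal_absolutelyContinuous' 0 one_ne_zero).isOpenPosMeasure
  rw [← map_pi_eq_stdGaussian]
  exact (PiLp.continuous_toLp 2 _).isOpenPosMeasure_map (WithLp.toLp_surjective 2)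

/-- The orthogonal projections of a standard Gaussian vector to a subspace and to its orthogonal
complement are independent. -/
theorem map_prod_starProjection_stdGaussian (W : Submodule ℝ (E d)) :
    ((stdGaussian (E d)).prod (stdGaussian (E d))).map
      (fun p => W.starProjection p.1 + Wᗮ.starProjection p.2) = stdGaussian (E d) := by
  have : IsProbabilityMeasure (((stdGaussian (E d)).prod (stdGaussian (E d))).map
      (fun p => W.starProjection p.1 + Wᗮ.starProjection p.2)) :=
    Measure.isProbabilityMeasure_map (by fun_prop)
  refine Measure.ext_of_charFun (funext fun t => ?_)
  rw [charFun_apply, integral_map (by fun_prop) (by fun_prop)]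
  simp_rw [inner_add_left, Submodule.inner_starProjection_left_eq_right, Complex.ofReal_add,
    add_mul, Complex.exp_add]
  rw [integral_prod_mul (fun x : E d => Complex.exp ((inner ℝ x (W.starProjection t) : ℝ) *
    Complex.I)) fun x : E d => Complex.exp ((inner ℝ x (Wᗮ.starProjection t) : ℝ) * Complex.I),
    ← charFun_apply, ← charFun_apply, charFun_stdGaussian, charFun_stdGaussian,
    charFun_stdGaussian, ← Complex.exp_add]
  congr 1
  -- By Pythagoras, the exponents of the two Gaussian characteristic functions add up to that of
  -- `t`.
  have := Submodule.norm_sq_eq_add_norm_sq_starProjection t W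
  have h := congrArg (fun r : ℝ => (r : ℂ)) this
  simp only [Complex.ofReal_add, Complex.ofReal_pow] at h
  rw [h]
  ring

theorem IsGaussianGiven.unique {V : AffineSubspace ℝ (E d)} {ν ν' : Measure (E d)}
    (h : IsGaussianGiven V ν) (h' : IsGaussianGiven V ν') : ν = ν' := by
  have := h.1
  have := h'.1
  exact ext_of_forall_integral_eq_of_IsFiniteMeasure fun f =>
    tendsto_nhds_unique (h.2 f) (h'.2 f)

variable (V : AffineSubspace ℝ (E d)) [Nonempty V]

/-- The law of the orthogonal projection to `V` of a standard Gaussian vector. -/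
def gaussianOn : Measure (E d) :=
  (stdGaussian (E d)).map fun x => (EuclideanGeometry.orthogonalProjection V x : E d)

theorem continuous_orthogonalProjection_coe :
    Continuous fun x => (EuclideanGeometry.orthogonalProjection V x : E d) :=
  continuous_subtype_val.comp (EuclideanGeometry.orthogonalProjection V).continuous

instance : IsProbabilityMeasure (gaussianOn V) :=
  Measure.isProbabilityMeasure_map (continuous_orthogonalProjection_coe V).aemeasurable

variable {V} in
theorem orthogonalProjection_eq_add {v : E d} (hv : v ∈ V) (x : E d) :
    (EuclideanGeometry.orthogonalProjection V x : E d) =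
      V.direction.starProjection x + V.directionᗮ.starProjection v := by
  rw [EuclideanGeometry.orthogonalProjection_apply_mem V hv]
  have := V.direction.starProjection_add_starProjection_orthogonal v
  simp only [vsub_eq_sub, vadd_eq_add, map_sub, Submodule.coe_sub,
    Submodule.coe_orthogonalProjectionOnto_apply]
  nth_rw 2 [← this]
  abel

variable {V} in
theorem mem_cthickening_iff {v : E d} (hv : v ∈ V) {ε : ℝ} (hε : 0 ≤ ε) (x : E d) :
    x ∈ Metric.cthickening ε (V : Set (E d)) ↔
      dist (V.directionᗮ.starProjection x) (V.directionᗮ.starProjection v) ≤ ε := by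
  rw [Metric.cthickening_eq_preimage_infEDist, Set.mem_preimage, Set.mem_Iic,
    ENNReal.le_ofReal_iff_toReal_le (Metric.infEDist_ne_top ⟨v, hv⟩) hε]
  change Metric.infDist x (V : Set (E d)) ≤ ε ↔ _
  rw [← EuclideanGeometry.dist_orthogonalProjection_eq_infDist, orthogonalProjection_eq_add hv]
  nth_rw 1 [← V.direction.starProjection_add_starProjection_orthogonal x]
  rw [dist_add_left]

variable {V} in
-- Membership in the thickening depends only on the component orthogonal to `V`, so conditioning
-- leaves the component along `V` standard Gaussian and independent of it.
theorem integral_cond_cthickening (f : E d →ᵇ ℝ) {ε : ℝ} (hε : 0 ≤ ε) :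
    ∫ x, f x ∂((stdGaussian (E d))[|Metric.cthickening ε (V : Set (E d))]) =
      ∫ y, ∫ x, f (V.direction.starProjection x + V.directionᗮ.starProjection y)
        ∂stdGaussian (E d) ∂((stdGaussian (E d))[|Metric.cthickening ε (V : Set (E d))]) := by
  obtain ⟨v, hv⟩ := ‹Nonempty V›
  set S := Metric.cthickening ε (V : Set (E d)) with hS
  have hSm : MeasurableSet S := Metric.isClosed_cthickening.measurableSet
  have hmem : ∀ x y, V.direction.starProjection x + V.directionᗮ.starProjection y ∈ S ↔ y ∈ S := by
    intro x y
    rw [hS, mem_cthickening_iff hv hε, mem_cthickening_iff hv hε, map_add,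
      Submodule.starProjection_orthogonal_apply_eq_zero (Submodule.starProjection_apply_mem _ _),
      zero_add, Submodule.starProjection_eq_self_iff.2 (Submodule.starProjection_apply_mem _ _)]
  -- Both sides carry the same normalising factor, which cancels.
  rw [ProbabilityTheory.cond, integral_smul_measure, integral_smul_measure]
  congr 1
  rw [← integral_indicator hSm, ← integral_indicator hSm]
  have hfm : Measurable (S.indicator f) := f.continuous.measurable.indicator hSm
  conv_lhs => rw [← map_prod_starProjection_stdGaussian V.direction]
  rw [integral_map (by fun_prop) hfm.aestronglyMeasurable, integral_prod_symm]
  · refine integral_congr_ae (.of_forall fun y => ?_)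
    by_cases hy : y ∈ S
    · simp only [Set.indicator_of_mem, hmem, hy]
    · simp only [Set.indicator_of_notMem, hmem, hy, not_false_eq_true, integral_zero]
  · refine Integrable.of_bound (C := ‖f‖) (hfm.comp (by fun_prop)).aestronglyMeasurable
      (.of_forall fun p => ?_)
    exact (norm_indicator_le_norm_self _ _).trans (f.norm_coe_le_norm _)

/-- Averaging over the component along `V` turns `f` into a continuous function `g` of the
orthogonal component. Under the conditional law that component is within `ε` of the one shared by
all points of `V`. -/
theorem isGaussianGiven_gaussianOn : IsGaussianGiven V (gaussianOn V) := by
  refine ⟨inferInstance, fun f => ?_⟩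
  obtain ⟨v, hv⟩ := ‹Nonempty V›
  let g : E d → ℝ := fun z => ∫ x, f (V.direction.starProjection x + z) ∂stdGaussian (E d)
  have hg : Continuous g := by
    refine continuous_of_dominated (bound := fun _ => ‖f‖) (fun z => ?_)
      (fun z => .of_forall fun x => f.norm_coe_le_norm _) (integrable_const _)
      (.of_forall fun x => by fun_prop)
    exact (f.continuous.comp (by fun_prop)).aestronglyMeasurable
  have hlim : ∫ x, f x ∂(gaussianOn V) = g (V.directionᗮ.starProjection v) := by
    rw [gaussianOn, integral_map (continuous_orthogonalProjection_coe V).aemeasurable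
      f.continuous.aestronglyMeasurable]
    simp_rw [orthogonalProjection_eq_add hv]
    rfl
  rw [hlim, Metric.tendsto_nhds]
  intro δ hδ
  obtain ⟨η, hη, hgη⟩ := Metric.continuous_iff.1 hg (V.directionᗮ.starProjection v) (δ / 2)
    (half_pos hδ)
  filter_upwards [Ioo_mem_nhdsGT hη] with ε hε
  rw [integral_cond_cthickening f hε.1.le]
  -- Positivity makes the conditional law a probability measure; `cond` on a null set would be zero.
  have hpos : stdGaussian (E d) (Metric.cthickening ε (V : Set (E d))) ≠ 0 := by
    refine ne_of_gt (lt_of_lt_of_le (Metric.measure_ball_pos (stdGaussian (E d)) v hε.1)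
      (measure_mono ?_))
    exact Metric.ball_subset_closedBall.trans (Metric.closedBall_subset_cthickening hv ε)
  have := cond_isProbabilityMeasure hpos
  rw [dist_eq_norm]
  have hsub : (∫ y, g (V.directionᗮ.starProjection y)
        ∂((stdGaussian (E d))[|Metric.cthickening ε (V : Set (E d))])) -
        g (V.directionᗮ.starProjection v) =
      ∫ y, (g (V.directionᗮ.starProjection y) - g (V.directionᗮ.starProjection v))
        ∂((stdGaussian (E d))[|Metric.cthickening ε (V : Set (E d))]) := by
    rw [integral_sub _ (integrable_const _)]
    · simp
    · refine Integrable.of_bound (C := ‖f‖) (hg.comp (by fun_prop)).aestronglyMeasurable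
        (.of_forall fun y => ?_)
      refine (norm_integral_le_of_norm_le_const (.of_forall fun x => f.norm_coe_le_norm _)).trans ?_
      simp
  change ‖(∫ y, g (V.directionᗮ.starProjection y) ∂_) - _‖ < δ
  rw [hsub]
  refine lt_of_le_of_lt (norm_integral_le_of_norm_le_const (C := δ / 2) ?_) ?_
  · filter_upwards [ae_cond_mem (μ := stdGaussian (E d))
      Metric.isClosed_cthickening.measurableSet] with y hy
    rw [mem_cthickening_iff hv hε.1.le] at hy
    rw [← dist_eq_norm]
    exact (hgη _ (hy.trans_lt hε.2)).le
  · simpa using hδ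

theorem isGaussianGiven_gaussianGiven : IsGaussianGiven V (gaussianGiven V) := by
  have h : ∃ ν, IsGaussianGiven V ν := ⟨_, isGaussianGiven_gaussianOn V⟩
  rw [gaussianGiven, dif_pos h]
  exact h.choose_spec

theorem gaussianGiven_eq_gaussianOn : gaussianGiven V = gaussianOn V :=
  (isGaussianGiven_gaussianGiven V).unique (isGaussianGiven_gaussianOn V)

end Gaussian

/-! ### Measurability of `φ` -/

section Phi

variable {d : ℕ}

/-- Affine independence is an open condition on tuples, so this form lets
`measurableSet_exists_tuple_mem` measure the dimension. -/
theorem le_finrank_direction_affineSpan_iff (A : Set (E d)) (k : ℕ) :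
    (A.Nonempty ∧ k ≤ Module.finrank ℝ (affineSpan ℝ A).direction) ↔
      ∃ y ∈ {y : Fin (k + 1) → E d | AffineIndependent ℝ y}, ∀ i, y i ∈ A := by
  constructor
  · rintro ⟨hA, hk⟩
    obtain ⟨t, htA, hspan, hind⟩ := exists_affineIndependent ℝ (E d) A
    have : Finite t := finite_set_of_fin_dim_affineIndependent ℝ hind
    have := Fintype.ofFinite t
    have : Nonempty t := by
      rw [Set.nonempty_coe_sort, ← affineSpan_nonempty ℝ, hspan, affineSpan_nonempty]
      exact hA
    have hcard := hind.finrank_vectorSpan_add_one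
    rw [Subtype.range_coe, ← direction_affineSpan, hspan] at hcard
    obtain ⟨e⟩ : Nonempty (Fin (k + 1) ↪ t) := by
      apply Function.Embedding.nonempty_of_card_le
      rw [Fintype.card_fin]
      exact (Nat.add_le_add_right hk 1).trans hcard.le
    exact ⟨fun i => e i, hind.comp_embedding e, fun i => htA (e i).2⟩
  · rintro ⟨y, hy, hyA⟩
    refine ⟨⟨y 0, hyA 0⟩, ?_⟩
    rw [direction_affineSpan, ← AffineIndependent.finrank_vectorSpan hy (Fintype.card_fin _)]
    exact Submodule.finrank_mono (vectorSpan_mono ℝ (Set.range_subset_iff.2 hyA))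

theorem measurable_finrank_direction_affineSpan :
    Measurable fun A : CO d => Module.finrank ℝ (affineSpan ℝ A.carrier).direction := by
  refine measurable_of_Ici fun k => ?_
  rcases k with _ | k
  -- The bound `0` is separate because the empty set also satisfies it; a positive bound forces
  -- nonemptiness.
  · convert MeasurableSet.univ
    ext A
    simp
  · convert measurableSet_exists_tuple_mem (B := fun A : CO d => A.carrier)
      CO.measurable_infEDist (isOpen_setOfPred_affineIndependent (𝕜 := ℝ) (ι := Fin (k + 1 + 1)))
      using 1
    ext A
    simp only [Set.mem_preimage, Set.mem_Ici, Set.mem_ofPred_eq]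
    refine ⟨fun h => (le_finrank_direction_affineSpan_iff A.carrier (k + 1)).1 ⟨?_, h⟩,
      fun h => ((le_finrank_direction_affineSpan_iff A.carrier (k + 1)).2 h).2⟩
    rw [Set.nonempty_iff_ne_empty]
    intro h0
    rw [h0, AffineSubspace.span_empty, AffineSubspace.direction_bot, finrank_bot] at h
    omega

theorem measurable_infEDist_uncurry {T : Type*} [MeasurableSpace T] {B : T → Set (E d)}
    (hB : ∀ x, Measurable fun t => Metric.infEDist x (B t)) :
    Measurable fun p : T × E d => Metric.infEDist p.2 (B p.1) := by
  rw [funext fun p : T × E d => infEDist_eq_iInf_denseSeq p.2 (B p.1)]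
  exact .iInf fun n => ((hB _).comp measurable_fst).add (measurable_snd.edist measurable_const)

/-- The projection is the unique nearest point of `V`, so `A` is as close to `x` as `V` is exactly
when it contains that point. This expresses the event through distances alone. -/
theorem orthogonalProjection_mem_iff {V : AffineSubspace ℝ (E d)} [Nonempty V] {A : Set (E d)}
    (hA : IsClosed A) (hne : A.Nonempty) (hAV : A ⊆ V) (x : E d) :
    (EuclideanGeometry.orthogonalProjection V x : E d) ∈ A ↔
      Metric.infEDist x A ≤ Metric.infEDist x (V : Set (E d)) := by
  have hV : (V : Set (E d)).Nonempty := hne.mono hAV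
  rw [← ENNReal.toReal_le_toReal (Metric.infEDist_ne_top hne) (Metric.infEDist_ne_top hV)]
  change _ ↔ Metric.infDist x A ≤ Metric.infDist x V
  rw [← EuclideanGeometry.dist_orthogonalProjection_eq_infDist]
  refine ⟨fun h => Metric.infDist_le_dist_of_mem h, fun h => ?_⟩
  obtain ⟨y, hy, hxy⟩ := hA.exists_infDist_eq_dist hne x
  rw [(EuclideanGeometry.dist_orthogonalProjection_eq_dist_iff_eq_of_mem (hAV hy)).1]
  · exact hy
  · refine le_antisymm ?_ (hxy ▸ h)
    rw [EuclideanGeometry.dist_orthogonalProjection_eq_infDist]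
    exact Metric.infDist_le_dist_of_mem (hAV hy)

theorem gaussianGiven_affineSpan_apply (A : CO d) (hne : A.carrier.Nonempty) :
    gaussianGiven (affineSpan ℝ A.carrier) A.carrier = stdGaussian (E d)
      {x | Metric.infEDist x A.carrier ≤
        Metric.infEDist x (affineSpan ℝ A.carrier : Set (E d))} := by
  have : Nonempty (affineSpan ℝ A.carrier) := ((affineSpan_nonempty ℝ).2 hne).to_subtype
  rw [gaussianGiven_eq_gaussianOn, gaussianOn, Measure.map_apply
    (continuous_orthogonalProjection_coe _).measurable A.isClosed.measurableSet]
  congr 1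
  ext x
  exact orthogonalProjection_mem_iff A.isClosed hne (subset_affineSpan ℝ _) x

theorem phi_of_eq_empty {A : CO d} (h : A.carrier = ∅) : phi A = -1 := by
  simp [phi, affDim, h]

theorem phi_of_nonempty {A : CO d} (h : A.carrier.Nonempty) :
    phi A = Module.finrank ℝ (affineSpan ℝ A.carrier).direction +
      (gaussianGiven (affineSpan ℝ A.carrier)).real A.carrier := by
  have : ((affineSpan ℝ A.carrier : Set (E d))) ≠ ∅ :=
    ((affineSpan_nonempty ℝ).2 h).ne_empty
  rw [phi, affDim, if_neg this, Int.cast_natCast]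

theorem measurable_phi : Measurable (phi : CO d → ℝ) := by
  classical
  have hset : MeasurableSet {A : CO d | A.carrier = ∅} := by
    simp_rw [← Metric.infEDist_eq_top_iff (x := (0 : E d))]
    exact measurableSet_eq_fun (CO.measurable_infEDist 0) measurable_const
  have heq : (phi : CO d → ℝ) = fun A => if A.carrier = ∅ then -1 else
      (Module.finrank ℝ (affineSpan ℝ A.carrier).direction : ℝ) +
      (stdGaussian (E d) {x | Metric.infEDist x A.carrier ≤
        Metric.infEDist x (affineSpan ℝ A.carrier : Set (E d))}).toReal := by
    funext A
    split_ifs with h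
    · exact phi_of_eq_empty h
    · have hne := Set.nonempty_iff_ne_empty.2 h
      rw [phi_of_nonempty hne, measureReal_def, gaussianGiven_affineSpan_apply A hne]
  rw [heq]
  refine Measurable.ite hset measurable_const (.add ?_ (.ennreal_toReal ?_))
  · exact (measurable_from_nat (f := fun n : ℕ => (n : ℝ))).comp
      measurable_finrank_direction_affineSpan
  -- The event is a section of a jointly measurable set of pairs `(A, x)`, so its mass is measurable
  -- in `A`.
  · exact measurable_measure_prodMk_left (measurableSet_le
      (measurable_infEDist_uncurry CO.measurable_infEDist)
      (measurable_infEDist_uncurry (measurable_infEDist_affineSpan CO.measurable_infEDist)))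

/-! ### Strict monotonicity of `φ` -/

/-- Translating `b` to the origin views `B` inside its own direction space, where it is
full-dimensional; a convex `B` then has nonempty interior there. -/
theorem affineSpan_preimage_vadd_eq_top {B : Set (E d)} {b : E d} (hb : b ∈ B) :
    affineSpan ℝ {w : (affineSpan ℝ B).direction | (w : E d) + b ∈ B} = ⊤ := by
  have h0 : (0 : (affineSpan ℝ B).direction) ∈
      {w : (affineSpan ℝ B).direction | (w : E d) + b ∈ B} := by simpa using hb
  rw [AffineSubspace.affineSpan_eq_top_iff_vectorSpan_eq_top_of_nonempty ℝ _ _ ⟨0, h0⟩]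
  apply Submodule.map_injective_of_injective (f := (affineSpan ℝ B).direction.subtype)
    (Submodule.injective_subtype _)
  rw [Submodule.map_top, Submodule.range_subtype, vectorSpan_eq_span_vsub_set_right ℝ h0,
    Submodule.map_span]
  refine Eq.trans ?_ ((direction_affineSpan ℝ B).trans
    (vectorSpan_eq_span_vsub_set_right ℝ hb)).symm
  congr 1
  ext z
  constructor
  · rintro ⟨_, ⟨w, hw, rfl⟩, rfl⟩
    exact ⟨_, hw, by simp⟩
  · rintro ⟨y, hy, rfl⟩
    have hmem : y - b ∈ (affineSpan ℝ B).direction :=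
      AffineSubspace.vsub_mem_direction (subset_affineSpan ℝ B hy) (subset_affineSpan ℝ B hb)
    exact ⟨⟨y - b, hmem⟩, ⟨⟨y - b, hmem⟩, by simpa using hy, by simp⟩, by simp⟩

/-- A relatively open nonempty part of a convex set is charged by the conditioned Gaussian
distribution. -/
theorem gaussianOn_affineSpan_diff_pos {A B : Set (E d)} (hA : IsClosed A) (hB : Convex ℝ B)
    [Nonempty (affineSpan ℝ B)] (hBA : (B \ A).Nonempty) :
    0 < gaussianOn (affineSpan ℝ B) (B \ A) := by
  obtain ⟨b, hb, hbA⟩ := hBA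
  set W := (affineSpan ℝ B).direction with hW
  let C : Set W := {w : W | (w : E d) + b ∈ B}
  have hC : Convex ℝ C := by
    have : C = (W.subtype : W →ₗ[ℝ] E d) ⁻¹' ((fun z => z + b) ⁻¹' B) := rfl
    rw [this]
    exact (hB.translate_preimage_left b).linear_preimage _
  have hint : (interior C).Nonempty :=
    hC.interior_nonempty_iff_affineSpan_eq_top.2 (affineSpan_preimage_vadd_eq_top hb)
  let D : Set W := {w : W | (w : E d) + b ∉ A}
  have hD : IsOpen D :=
    hA.isOpen_compl.preimage (by fun_prop : Continuous fun w : W => (w : E d) + b)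
  -- The point `b` may lie on the relative boundary of `B`, but interior points of `C` approach `0`
  -- and eventually avoid `A`.
  have h0 : (0 : W) ∈ closure (interior C) := by
    rw [hC.closure_interior_eq_closure_of_nonempty_interior hint]
    exact subset_closure (by simpa [C] using hb)
  obtain ⟨w, hwD, hwC⟩ := mem_closure_iff.1 h0 D hD (by simpa [D] using hbA)
  have hcont : Continuous fun x : E d => W.orthogonalProjectionOnto (x - b) := by fun_prop
  have hopen : IsOpen ((fun x : E d => W.orthogonalProjectionOnto (x - b)) ⁻¹' (D ∩ interior C)) :=
    (hD.inter isOpen_interior).preimage hcont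
  have hpos := hopen.measure_pos (stdGaussian (E d)) ⟨w + b, by simpa using ⟨hwD, hwC⟩⟩
  refine hpos.trans_le ((measure_mono ?_).trans
    (Measure.le_map_apply (continuous_orthogonalProjection_coe _).aemeasurable _))
  rintro x ⟨hxD, hxC⟩
  rw [Set.mem_preimage, EuclideanGeometry.orthogonalProjection_apply_mem _
    (subset_affineSpan ℝ B hb)]
  exact ⟨(interior_subset hxC : _ ∈ C), hxD⟩

theorem finrank_lt_phi {A : CO d} (hA : A.carrier.Nonempty) :
    (Module.finrank ℝ (affineSpan ℝ A.carrier).direction : ℝ) < phi A := by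
  have : Nonempty (affineSpan ℝ A.carrier) := ((affineSpan_nonempty ℝ).2 hA).to_subtype
  rw [phi_of_nonempty hA, lt_add_iff_pos_right, gaussianGiven_eq_gaussianOn, measureReal_def]
  have := gaussianOn_affineSpan_diff_pos isClosed_empty A.convex (by simpa using hA)
  rw [Set.sdiff_empty] at this
  exact ENNReal.toReal_pos this.ne' (by finiteness)

theorem phi_le_finrank_add_one {A : CO d} (hA : A.carrier.Nonempty) :
    phi A ≤ Module.finrank ℝ (affineSpan ℝ A.carrier).direction + 1 := by
  have : Nonempty (affineSpan ℝ A.carrier) := ((affineSpan_nonempty ℝ).2 hA).to_subtype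
  rw [phi_of_nonempty hA, gaussianGiven_eq_gaussianOn]
  gcongr
  exact measureReal_le_one

theorem strictMono_phi : StrictMono (phi : CO d → ℝ) := by
  intro A B hAB
  have hle : A.carrier ⊆ B.carrier := hAB.le
  have hdiff : (B.carrier \ A.carrier).Nonempty := Set.sdiff_nonempty.2 fun h => hAB.not_ge h
  have hB : B.carrier.Nonempty := hdiff.mono Set.sdiff_subset
  rcases A.carrier.eq_empty_or_nonempty with hA | hA
  · rw [phi_of_eq_empty hA]
    refine lt_trans ?_ (finrank_lt_phi hB)
    have : (0 : ℝ) ≤ Module.finrank ℝ (affineSpan ℝ B.carrier).direction := by positivity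
    linarith
  rcases (affineSpan_mono ℝ hle).eq_or_lt with hs | hs
  · have : Nonempty (affineSpan ℝ B.carrier) := ((affineSpan_nonempty ℝ).2 hB).to_subtype
    -- With equal spans the dimensions and the measures coincide, so only the mass of the difference
    -- matters.
    rw [phi_of_nonempty hA, phi_of_nonempty hB, hs, gaussianGiven_eq_gaussianOn]
    have hpos := gaussianOn_affineSpan_diff_pos A.isClosed B.convex hdiff
    have hpos' : 0 < (gaussianOn (affineSpan ℝ B.carrier)).real (B.carrier \ A.carrier) :=
      ENNReal.toReal_pos hpos.ne' (by finiteness)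
    rw [measureReal_sdiff hle A.isClosed.measurableSet] at hpos'
    linarith
  · have hdir := AffineSubspace.direction_lt_of_nonempty hs
      ((affineSpan_nonempty ℝ).2 hA)
    have hlt := Submodule.finrank_lt_finrank_of_lt hdir
    have hlt' : (Module.finrank ℝ (affineSpan ℝ A.carrier).direction : ℝ) + 1 ≤
        Module.finrank ℝ (affineSpan ℝ B.carrier).direction := by exact_mod_cast hlt
    exact ((phi_le_finrank_add_one hA).trans hlt').trans_lt (finrank_lt_phi hB)

end Phi

end ConvexLattice

end

theorem theoremT (d : ℕ) :
    (ConvexLattice.A1 (ConvexLattice.CO d) ∧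
      ConvexLattice.A2 (ConvexLattice.CO d) ∧
      ConvexLattice.A3 (ConvexLattice.CO d)) ∧
    (∀ V : AffineSubspace ℝ (ConvexLattice.E d), (V : Set (ConvexLattice.E d)).Nonempty →
      ConvexLattice.IsGaussianGiven V (ConvexLattice.gaussianGiven V)) ∧
    StrictMono (ConvexLattice.phi : ConvexLattice.CO d → ℝ) ∧
    Measurable (ConvexLattice.phi : ConvexLattice.CO d → ℝ) := by
  refine ⟨⟨ConvexLattice.CO.measurableSet_le,
    ⟨ConvexLattice.CO.measurable_iSup, ConvexLattice.CO.measurable_iInf⟩,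
    ConvexLattice.phi, ConvexLattice.strictMono_phi, ConvexLattice.measurable_phi⟩, ?_,
    ConvexLattice.strictMono_phi, ConvexLattice.measurable_phi⟩
  intro V hV
  have := hV.to_subtype
  exact ConvexLattice.isGaussianGiven_gaussianGiven V
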